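/- Let $A\in\mathbb C^{n\times n}$ have spectrum $\sigma(A)$, let $z_1,\dots,z_N\in\mathbb C$ be (possibly repeated) points, and let $f$ be a function analytic on an open set $U\subseteq\mathbb C$ that contains the convex hull of $\sigma(A)\cup\{z_1,\dots,z_N\}$. Let $u,v$ be complex polynomials with $\deg u\le N-1$, $v(z_k)\ne0$ for $k=1,\dots,N$, and $v(\lambda)\neq0$ for all $\lambda\in\sigma(A)$. Suppose that the rational function $r=u/v$ interpolates $f$ at $z_1,\dots,z_N$ with multiplicities, that is, for every $k$, $$r^{(j)}(z_k)=f^{(j)}(z_k),\qquad 0\le j\le n_k-1,$$ where $n_k$ is the number of indices $i$ with $z_i=z_k$. For a function $g$ analytic on a neighborhood of the spectrum of a square matrix $B$, put $$g(B)=\frac1{2\pi i}\int_\Gamma g(\lambda)(\lambda\mathbf 1-B)^{-1}\,d\lambda,$$ where the contour $\Gamma$ encloses the spectrum of $B$ (for instance, $\Gamma$ consists of sufficiently small positively oriented circles around the eigenvalues of $B$). Let $\Omega(z)=\prod_{k=1}^N(z-z_k)$. Then the matrix $v(A)$ is invertible, the matrix-valued integrand below is defined and continuous on the set $1\ge t_1\ge\dots\ge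 t_N\ge0$, and $$f(A)-r(A)=\Omega(A)\,[v(A)]^{-1}\int_0^1\int_0^{t_1}\!\!\dots\int_0^{t_{N-1}}(vf)^{(N)}\bigl((1-t_1)z_1\mathbf1+(t_1-t_2)z_2\mathbf1+\dots+(t_{N-1}-t_N)z_N\mathbf1+t_NA\bigr)\,dt_N\,dt_{N-1}\dots dt_1 .$$ -/

import Mathlib

noncomputable section

namespace RatInterp

open Complex

/-- The circles of radius `ε` around the eigenvalues of `A` form a contour enclosing the spectrum
of `A` on which the Cauchy integral of `f` may be taken: the closed discs that they bound are
pairwise disjoint, and `f` is analytic on each of these closed discs. -/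
structure IsAdmissibleRadius {n : ℕ} (f : ℂ → ℂ) (A : Matrix (Fin n) (Fin n) ℂ) (ε : ℝ) :
    Prop where
  pos : 0 < ε
  disjoint : (spectrum ℂ A).PairwiseDisjoint (fun μ => Metric.closedBall μ ε)
  analytic : ∀ μ ∈ spectrum ℂ A, AnalyticOnNhd ℂ f (Metric.closedBall μ ε)

/-- `(2πi)⁻¹ ∫_Γ f(w) (w 1 - A)⁻¹ dw`, taken entrywise, where `Γ` is the union of the positively
oriented circles of radius `ε` around the eigenvalues of `A`. -/
def cauchyMatrix {n : ℕ} (f : ℂ → ℂ) (A : Matrix (Fin n) (Fin n) ℂ) (ε : ℝ) :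
    Matrix (Fin n) (Fin n) ℂ :=
  Matrix.of fun i j => (2 * Real.pi * I)⁻¹ *
    ∑ μ ∈ (Matrix.finite_spectrum A).toFinset,
      ∮ w in C(μ, ε), f w * (w • (1 : Matrix (Fin n) (Fin n) ℂ) - A)⁻¹ i j

open Classical in
/-- The analytic function `f` applied to the matrix `A`, that is,
`f(A) = (2πi)⁻¹ ∫_Γ f(w) (w 1 - A)⁻¹ dw` with `Γ` enclosing the spectrum of `A`.
It does not depend on the admissible radius (`matFun_eq_cauchyMatrix`), and an admissible radius
exists when `f` is analytic at all eigenvalues (`exists_isAdmissibleRadius`). -/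
def matFun {n : ℕ} (f : ℂ → ℂ) (A : Matrix (Fin n) (Fin n) ℂ) : Matrix (Fin n) (Fin n) ℂ :=
  if h : ∃ ε, IsAdmissibleRadius f A ε then cauchyMatrix f A h.choose else 0

/-- Multiplicity of the node `z k`: the number of its repetitions in the list `z`. -/
def nodeMult {N : ℕ} (z : Fin N → ℂ) (k : Fin N) : ℕ :=
  (Finset.univ.filter fun i => z i = z k).card

/-- `r` interpolates `f` at the nodes `z`, counted with multiplicities. -/
def Interpolates {N : ℕ} (r f : ℂ → ℂ) (z : Fin N → ℂ) : Prop :=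
  ∀ k : Fin N, ∀ j < nodeMult z k, iteratedDeriv j r (z k) = iteratedDeriv j f (z k)

/-- The polynomial `Ω = ∏ (X - z_k)`. -/
def nodePoly {N : ℕ} (z : Fin N → ℂ) : Polynomial ℂ :=
  ∏ k, (Polynomial.X - Polynomial.C (z k))

/-- The iterated integral
`∫_0^s ∫_0^{t_1} … ∫_0^{t_{N-1}} F(t_1, …, t_N) dt_N … dt_2 dt_1`. -/
def iterIntegral : (N : ℕ) → ((Fin N → ℝ) → ℂ) → ℝ → ℂ
  | 0, F, _ => F Fin.elim0
  | N + 1, F, s => ∫ t in (0 : ℝ)..s, iterIntegral N (fun τ => F (Fin.cons t τ)) t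

/-- The iterated integral of a matrix-valued function, taken entrywise. -/
def iterIntegralMatrix {n : ℕ} (N : ℕ) (F : (Fin N → ℝ) → Matrix (Fin n) (Fin n) ℂ) (s : ℝ) :
    Matrix (Fin n) (Fin n) ℂ :=
  Matrix.of fun i j => iterIntegral N (fun t => F t i j) s

/-- The domain of integration `1 ≥ t_1 ≥ t_2 ≥ … ≥ t_N ≥ 0`. -/
def orderedSimplex (N : ℕ) : Set (Fin N → ℝ) :=
  {t | Antitone t ∧ ∀ k, t k ∈ Set.Icc (0 : ℝ) 1}

/-- The matrix `(1-t_1) z_1 1 + (t_1-t_2) z_2 1 + … + (t_{N-1}-t_N) z_N 1 + t_N A`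
(with `t_0 = 1`). -/
def nodeMatrix {n N : ℕ} (z : Fin N → ℂ) (A : Matrix (Fin n) (Fin n) ℂ) (t : Fin N → ℝ) :
    Matrix (Fin n) (Fin n) ℂ :=
  let s : Fin (N + 1) → ℝ := Fin.cons 1 t
  (∑ k : Fin N, ((s k.castSucc - s k.succ : ℝ) : ℂ) • z k • (1 : Matrix (Fin n) (Fin n) ℂ))
    + (s (Fin.last N) : ℂ) • A

/-- An admissible radius exists as soon as `f` is analytic at the eigenvalues of `A`. -/
theorem exists_isAdmissibleRadius {n : ℕ} {f : ℂ → ℂ} {A : Matrix (Fin n) (Fin n) ℂ}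
    (hf : AnalyticOnNhd ℂ f (spectrum ℂ A)) : ∃ ε, IsAdmissibleRadius f A ε := by
  have hfin := Matrix.finite_spectrum A
  have h1 : ∀ᶠ ε in nhdsWithin (0 : ℝ) (Set.Ioi 0), ∀ μ ∈ spectrum ℂ A,
      AnalyticOnNhd ℂ f (Metric.closedBall μ ε) := by
    rw [Filter.eventually_all_finite hfin]
    intro μ hμ
    obtain ⟨δ, hδ, hball⟩ := Metric.eventually_nhds_iff_ball.1 (hf μ hμ).eventually_analyticAt
    filter_upwards [Ioo_mem_nhdsGT hδ] with ε hε w hw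
    exact hball w (Metric.closedBall_subset_ball hε.2 hw)
  have h2 : ∀ᶠ ε in nhdsWithin (0 : ℝ) (Set.Ioi 0), ∀ μ ∈ spectrum ℂ A, ∀ ν ∈ spectrum ℂ A,
      μ ≠ ν → Disjoint (Metric.closedBall μ ε) (Metric.closedBall ν ε) := by
    rw [Filter.eventually_all_finite hfin]
    intro μ _
    rw [Filter.eventually_all_finite hfin]
    intro ν _
    by_cases h : μ = ν
    · simp [h]
    · have hd : 0 < dist μ ν / 2 := half_pos (dist_pos.2 h)
      filter_upwards [Ioo_mem_nhdsGT hd] with ε hε _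
      exact Metric.closedBall_disjoint_closedBall (by linarith [hε.2])
  obtain ⟨ε, ⟨ha, hb⟩, hc⟩ := ((h1.and h2).and self_mem_nhdsWithin).exists
  exact ⟨ε, hc, fun μ hμ ν hν h => hb μ hμ ν hν h, ha⟩

theorem differentiableAt_resolvent_entry {n : ℕ} {A : Matrix (Fin n) (Fin n) ℂ} (i j : Fin n)
    {w : ℂ} (hw : w ∉ spectrum ℂ A) :
    DifferentiableAt ℂ
      (fun w : ℂ => (w • (1 : Matrix (Fin n) (Fin n) ℂ) - A)⁻¹ i j) w := by
  have hdet : ∀ B : Matrix (Fin n) (Fin n) ℂ,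
      Differentiable ℂ (fun w : ℂ => (w • B - A).det) := by
    intro B
    simp only [Matrix.det_apply, Matrix.sub_apply, Matrix.smul_apply]
    fun_prop
  have hadj : Differentiable ℂ
      (fun w : ℂ => (w • (1 : Matrix (Fin n) (Fin n) ℂ) - A).adjugate i j) := by
    simp only [Matrix.adjugate_apply, Matrix.det_apply]
    have hentry : ∀ a b, Differentiable ℂ (fun w : ℂ =>
        ((w • (1 : Matrix (Fin n) (Fin n) ℂ) - A).updateRow j (Pi.single i 1)) a b) := by
      intro a b
      by_cases h : a = j
      · subst h; simp
      · simp only [Matrix.updateRow_ne h, Matrix.sub_apply, Matrix.smul_apply]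
        fun_prop
    fun_prop
  have hne : (w • (1 : Matrix (Fin n) (Fin n) ℂ) - A).det ≠ 0 := by
    rw [spectrum.notMem_iff, Algebra.algebraMap_eq_smul_one, Matrix.isUnit_iff_isUnit_det] at hw
    exact hw.ne_zero
  have h := ((hdet 1) w).inv hne |>.mul (hadj w)
  simpa [Matrix.inv_def, Pi.mul_def] using h

/-- The Cauchy integral does not depend on the admissible radius. -/
theorem cauchyMatrix_eq {n : ℕ} {f : ℂ → ℂ} {A : Matrix (Fin n) (Fin n) ℂ} {ε δ : ℝ}
    (hε : IsAdmissibleRadius f A ε) (hδ : IsAdmissibleRadius f A δ) :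
    cauchyMatrix f A ε = cauchyMatrix f A δ := by
  wlog h : δ ≤ ε generalizing ε δ
  · exact (this hδ hε (le_of_not_ge h)).symm
  ext i j
  simp only [cauchyMatrix, Matrix.of_apply]
  congr 1
  refine Finset.sum_congr rfl fun μ hμ => ?_
  rw [Set.Finite.mem_toFinset] at hμ
  have key : ∀ w ∈ Metric.closedBall μ ε \ Metric.ball μ δ, DifferentiableAt ℂ
      (fun w => f w * (w • (1 : Matrix (Fin n) (Fin n) ℂ) - A)⁻¹ i j) w := by
    intro w hw
    refine (hε.analytic μ hμ w hw.1).differentiableAt.mul (differentiableAt_resolvent_entry i j ?_)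
    intro hs
    by_cases hwμ : μ = w
    · exact hw.2 (hwμ ▸ Metric.mem_ball_self hδ.pos)
    · exact Set.disjoint_left.1 (hε.disjoint hμ hs hwμ) hw.1 (Metric.mem_closedBall_self hε.pos.le)
  refine Complex.circleIntegral_eq_of_differentiable_on_annulus_off_countable hδ.pos h
    Set.countable_empty (fun w hw => (key w hw).continuousAt.continuousWithinAt) ?_
  intro w hw
  exact key w ⟨Metric.ball_subset_closedBall hw.1.1,
    fun h' => hw.1.2 (Metric.ball_subset_closedBall h')⟩

theorem matFun_eq_cauchyMatrix {n : ℕ} {f : ℂ → ℂ} {A : Matrix (Fin n) (Fin n) ℂ} {ε : ℝ}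
    (hε : IsAdmissibleRadius f A ε) : matFun f A = cauchyMatrix f A ε := by
  have h : ∃ ε, IsAdmissibleRadius f A ε := ⟨ε, hε⟩
  rw [matFun, dif_pos h]
  exact cauchyMatrix_eq h.choose_spec hε

end RatInterp

end

/-!
Let `V` be a convex neighbourhood of the nodes and of the spectrum of `A`, inside the domain of `f`.
The function `v f - u` vanishes at the nodes at least as often as `Ω`, so `v f - u = Ω h` on `V`,
where `h w` is the divided difference of `v f - u` at `z_1, …, z_N, w`. By the Genocchi–Hermite
formula, `h w` is the integral over the simplex of the `N`-th derivative of `v f - u`, which is that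
of `v f` since `deg u < N`. Applying both sides to `A` gives `v(A) (f(A) - r(A)) = Ω(A) h(A)`, and
the contour integral in `h(A)` can be interchanged with the one over the simplex.
-/

namespace RatInterp

open Complex MeasureTheory Set Filter
open scoped Topology Polynomial

theorem exists_isOpen_convex_of_convexHull_subset {E : Type*} [NormedAddCommGroup E]
    [NormedSpace ℝ E] {S U : Set E} (hS : S.Finite) (hU : IsOpen U) (hSU : convexHull ℝ S ⊆ U) :
    ∃ V, IsOpen V ∧ Convex ℝ V ∧ S ⊆ V ∧ V ⊆ U := by
  obtain ⟨δ, hδ, hδU⟩ := (hS.isCompact_convexHull ℝ).exists_thickening_subset_open hU hSU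
  exact ⟨_, Metric.isOpen_thickening, (convex_convexHull ℝ S).thickening δ,
    (subset_convexHull ℝ S).trans (Metric.self_subset_thickening hδ _), hδU⟩

theorem eq_mul_inv_mul_of_commute {m R : Type*} [Fintype m] [DecidableEq m] [CommRing R]
    {P Q B C : Matrix m m R} (hPQ : Commute P Q) (hQ : IsUnit Q) (h : Q * B = P * C) :
    B = P * Q⁻¹ * C := by
  have hQQ := Matrix.mul_nonsing_inv Q ((Matrix.isUnit_iff_isUnit_det Q).1 hQ)
  refine hQ.mul_left_cancel ?_
  rw [h, ← mul_assoc, ← mul_assoc, ← hPQ.eq, mul_assoc P, hQQ, mul_one]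

theorem analyticAt_eval (p : ℂ[X]) (a : ℂ) : AnalyticAt ℂ (fun w => p.eval w) a :=
  AnalyticOnNhd.eval_polynomial p a (mem_univ a)

theorem analyticOnNhd_eval (p : ℂ[X]) (S : Set ℂ) : AnalyticOnNhd ℂ (fun w => p.eval w) S :=
  fun a _ => analyticAt_eval p a

section Contour

variable {n : ℕ} {A : Matrix (Fin n) (Fin n) ℂ} {V : Set ℂ} {ε : ℝ}

/-- The circles of radius `ε` around the eigenvalues of `A`, on which `cauchyMatrix f A ε`
integrates. -/
def contour (A : Matrix (Fin n) (Fin n) ℂ) (ε : ℝ) : Set ℂ :=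
  ⋃ μ ∈ spectrum ℂ A, Metric.sphere μ ε

/-- `(2πi)⁻¹ ∫_Γ φ(w) dw`, where `Γ` is `contour A ε`, positively oriented: the scalar integral of
which the entries of `cauchyMatrix f A ε` are instances. -/
noncomputable def contourIntegral (A : Matrix (Fin n) (Fin n) ℂ) (ε : ℝ) (φ : ℂ → ℂ) : ℂ :=
  (2 * Real.pi * I)⁻¹ * ∑ μ ∈ (Matrix.finite_spectrum A).toFinset, ∮ w in C(μ, ε), φ w

/-- The closed discs of radius `ε` around the eigenvalues of `A` are pairwise disjoint and
contained in `V`: then `contour A ε` computes `matFun f A` for every `f` analytic on `V`. -/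
structure IsContourRadius (A : Matrix (Fin n) (Fin n) ℂ) (V : Set ℂ) (ε : ℝ) : Prop where
  pos : 0 < ε
  disjoint : (spectrum ℂ A).PairwiseDisjoint fun μ => Metric.closedBall μ ε
  closedBall_subset : ∀ μ ∈ spectrum ℂ A, Metric.closedBall μ ε ⊆ V

theorem exists_isContourRadius (hV : IsOpen V) (hA : spectrum ℂ A ⊆ V) :
    ∃ ε, IsContourRadius A V ε := by
  obtain ⟨δ, hδ, hδV⟩ := (Matrix.finite_spectrum A).isCompact.exists_cthickening_subset_open hV hA
  obtain ⟨ε, hε⟩ := exists_isAdmissibleRadius (f := fun _ => 0) (A := A) analyticOnNhd_const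
  refine ⟨min ε δ, lt_min hε.pos hδ, hε.disjoint.mono fun μ => ?_, fun μ hμ => ?_⟩
  · exact Metric.closedBall_subset_closedBall (min_le_left ε δ)
  · exact (Metric.closedBall_subset_closedBall (min_le_right ε δ)).trans
      ((Metric.closedBall_subset_cthickening hμ δ).trans hδV)

theorem sphere_subset_contour {μ : ℂ} (hμ : μ ∈ spectrum ℂ A) : Metric.sphere μ ε ⊆ contour A ε :=
  subset_biUnion_of_mem (u := fun μ => Metric.sphere μ ε) hμ

theorem contourIntegral_congr (hε : 0 ≤ ε) {φ ψ : ℂ → ℂ} (h : EqOn φ ψ (contour A ε)) :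
    contourIntegral A ε φ = contourIntegral A ε ψ := by
  refine congrArg (_ * ·) (Finset.sum_congr rfl fun μ hμ => ?_)
  exact circleIntegral.integral_congr hε
    (h.mono (sphere_subset_contour ((Matrix.finite_spectrum A).mem_toFinset.1 hμ)))

theorem circleIntegrable_of_continuousOn_contour (hε : 0 ≤ ε) {φ : ℂ → ℂ}
    (hφ : ContinuousOn φ (contour A ε)) {μ : ℂ} (hμ : μ ∈ (Matrix.finite_spectrum A).toFinset) :
    CircleIntegrable φ μ ε :=
  (hφ.mono (sphere_subset_contour
    ((Matrix.finite_spectrum A).mem_toFinset.1 hμ))).circleIntegrable hε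

theorem contourIntegral_const_mul (c : ℂ) (φ : ℂ → ℂ) :
    contourIntegral A ε (fun w => c * φ w) = c * contourIntegral A ε φ := by
  simp only [contourIntegral, circleIntegral.integral_const_mul, ← Finset.mul_sum, mul_left_comm c]

theorem contourIntegral_sum (hε : 0 ≤ ε) {ι : Type*} (s : Finset ι) {φ : ι → ℂ → ℂ}
    (hφ : ∀ i ∈ s, ContinuousOn (φ i) (contour A ε)) :
    contourIntegral A ε (fun w => ∑ i ∈ s, φ i w) = ∑ i ∈ s, contourIntegral A ε (φ i) := by
  simp only [contourIntegral, ← Finset.mul_sum]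
  rw [Finset.sum_comm]
  refine congrArg _ (Finset.sum_congr rfl fun μ hμ => ?_)
  exact circleIntegral.integral_fun_sum fun i hi =>
    circleIntegrable_of_continuousOn_contour hε (hφ i hi) hμ

theorem contourIntegral_add (hε : 0 ≤ ε) {φ ψ : ℂ → ℂ} (hφ : ContinuousOn φ (contour A ε))
    (hψ : ContinuousOn ψ (contour A ε)) :
    contourIntegral A ε (fun w => φ w + ψ w) =
      contourIntegral A ε φ + contourIntegral A ε ψ := by
  have := contourIntegral_sum (A := A) hε Finset.univ (φ := ![φ, ψ])
    (by simp [Fin.forall_fin_two, hφ, hψ])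
  simpa [Fin.sum_univ_two] using this

theorem contourIntegral_eq_zero (hε : IsContourRadius A V ε) {φ : ℂ → ℂ}
    (hφ : AnalyticOnNhd ℂ φ V) : contourIntegral A ε φ = 0 := by
  refine mul_eq_zero_of_right _ (Finset.sum_eq_zero fun μ hμ => ?_)
  have hsub := hε.closedBall_subset μ ((Matrix.finite_spectrum A).mem_toFinset.1 hμ)
  exact circleIntegral_eq_zero_of_differentiable_on_off_countable hε.pos.le countable_empty
    (hφ.continuousOn.mono hsub)
    fun w hw => (hφ w (hsub (Metric.ball_subset_closedBall hw.1))).differentiableAt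

theorem IsContourRadius.eq_of_mem_closedBall (hε : IsContourRadius A V ε) {μ ν : ℂ}
    (hμ : μ ∈ spectrum ℂ A) (hν : ν ∈ spectrum ℂ A) (h : μ ∈ Metric.closedBall ν ε) : μ = ν :=
  hε.disjoint.elim_set hμ hν μ (Metric.mem_closedBall_self hε.pos.le) h

theorem IsContourRadius.notMem_spectrum (hε : IsContourRadius A V ε) {w : ℂ}
    (hw : w ∈ contour A ε) : w ∉ spectrum ℂ A := by
  intro hwA
  obtain ⟨μ, hμ, hwμ⟩ := mem_iUnion₂.1 hw
  obtain rfl := hε.eq_of_mem_closedBall hwA hμ (Metric.sphere_subset_closedBall hwμ)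
  exact hε.pos.ne (by simpa using hwμ)

theorem IsContourRadius.contour_subset (hε : IsContourRadius A V ε) : contour A ε ⊆ V :=
  iUnion₂_subset fun μ hμ => Metric.sphere_subset_closedBall.trans (hε.closedBall_subset μ hμ)

theorem IsContourRadius.continuousOn_sub_zpow (hε : IsContourRadius A V ε) {μ : ℂ}
    (hμ : μ ∈ spectrum ℂ A) (m : ℤ) : ContinuousOn (fun w => (w - μ) ^ m) (contour A ε) :=
  (continuousOn_id.sub continuousOn_const).zpow₀ m fun w hw =>
    Or.inl (sub_ne_zero.2 fun h : w = μ => hε.notMem_spectrum hw (h ▸ hμ))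

theorem circleIntegral_sub_zpow_of_notMem_closedBall {μ ν : ℂ} (hε : 0 ≤ ε)
    (h : μ ∉ Metric.closedBall ν ε) (m : ℤ) : (∮ w in C(ν, ε), (w - μ) ^ m) = 0 := by
  have hd : ∀ w ∈ Metric.closedBall ν ε, DifferentiableAt ℂ (fun w : ℂ => (w - μ) ^ m) w :=
    fun w hw => (differentiableAt_id.sub_const μ).zpow
      (Or.inl (sub_ne_zero.2 fun hwμ => h (hwμ ▸ hw)))
  exact circleIntegral_eq_zero_of_differentiable_on_off_countable hε countable_empty
    (fun w hw => (hd w hw).continuousAt.continuousWithinAt)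
    fun w hw => hd w (Metric.ball_subset_closedBall hw.1)

theorem contourIntegral_sub_zpow (hε : IsContourRadius A V ε) {μ : ℂ} (hμ : μ ∈ spectrum ℂ A)
    (m : ℤ) : contourIntegral A ε (fun w => (w - μ) ^ m) = if m = -1 then 1 else 0 := by
  rw [contourIntegral, Finset.sum_eq_single_of_mem μ ((Matrix.finite_spectrum A).mem_toFinset.2 hμ)
    fun ν hν hne => circleIntegral_sub_zpow_of_notMem_closedBall hε.pos.le (fun h => hne
      (hε.eq_of_mem_closedBall hμ ((Matrix.finite_spectrum A).mem_toFinset.1 hν) h).symm) m]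
  split_ifs with hm
  · simp only [hm, zpow_neg_one, circleIntegral.integral_sub_center_inv μ hε.pos.ne']
    exact inv_mul_cancel₀ two_pi_I_ne_zero
  · rw [circleIntegral.integral_sub_zpow_of_ne hm, mul_zero]

variable {X : Type*} [TopologicalSpace X] [T2Space X]
  [MeasurableSpace X] [BorelSpace X] {ν : Measure X} [IsFiniteMeasureOnCompacts ν] [SFinite ν]
  {K : Set X} {c : ℂ} {R : ℝ} {φ : X → ℂ → ℂ}

theorem integrable_prod_circleMap (hK : IsCompact K) (hR : 0 ≤ R)
    (hφ : ContinuousOn (Function.uncurry φ) (K ×ˢ Metric.sphere c R)) :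
    Integrable (fun p : X × ℝ => deriv (circleMap c R) p.2 • φ p.1 (circleMap c R p.2))
      ((ν.restrict K).prod (volume.restrict (Ioc 0 (2 * Real.pi)))) := by
  rw [Measure.prod_restrict]
  refine IntegrableOn.mono_set (ContinuousOn.integrableOn_compact (hK.prod isCompact_Icc) ?_)
    (prod_mono_right Ioc_subset_Icc_self)
  have hmaps : MapsTo (fun p : X × ℝ => (p.1, circleMap c R p.2)) (K ×ˢ Icc 0 (2 * Real.pi))
      (K ×ˢ Metric.sphere c R) := fun p hp => ⟨hp.1, circleMap_mem_sphere c hR p.2⟩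
  have hcirc : ContinuousOn (fun p : X × ℝ => φ p.1 (circleMap c R p.2))
      (K ×ˢ Icc 0 (2 * Real.pi)) := hφ.comp (by fun_prop) hmaps
  simp only [deriv_circleMap]
  exact (((continuous_circleMap 0 R).comp continuous_snd).mul continuous_const).continuousOn.smul
    hcirc

theorem integrableOn_circleIntegral (hK : IsCompact K) (hR : 0 ≤ R)
    (hφ : ContinuousOn (Function.uncurry φ) (K ×ˢ Metric.sphere c R)) :
    IntegrableOn (fun x => ∮ w in C(c, R), φ x w) K ν := by
  simp only [circleIntegral, intervalIntegral.integral_of_le Real.two_pi_pos.le]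
  exact (integrable_prod_circleMap hK hR hφ).integral_prod_left

theorem circleIntegral_setIntegral (hK : IsCompact K) (hR : 0 ≤ R)
    (hφ : ContinuousOn (Function.uncurry φ) (K ×ˢ Metric.sphere c R)) :
    (∮ w in C(c, R), ∫ x in K, φ x w ∂ν) = ∫ x in K, ∮ w in C(c, R), φ x w ∂ν := by
  simp only [circleIntegral, intervalIntegral.integral_of_le Real.two_pi_pos.le, ← integral_smul]
  exact (integral_integral_swap (integrable_prod_circleMap hK hR hφ)).symm

theorem circleIntegrable_setIntegral (hK : IsCompact K) (hR : 0 ≤ R)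
    (hφ : ContinuousOn (Function.uncurry φ) (K ×ˢ Metric.sphere c R)) :
    CircleIntegrable (fun w => ∫ x in K, φ x w ∂ν) c R := by
  rw [circleIntegrable_iff, intervalIntegrable_iff_integrableOn_Ioc_of_le Real.two_pi_pos.le,
    IntegrableOn]
  simpa only [integral_smul] using (integrable_prod_circleMap hK hR hφ).integral_prod_right

theorem contourIntegral_setIntegral (hε : 0 ≤ ε) (hK : IsCompact K)
    (hφ : ContinuousOn (Function.uncurry φ) (K ×ˢ contour A ε)) :
    contourIntegral A ε (fun w => ∫ x in K, φ x w ∂ν) =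
      ∫ x in K, contourIntegral A ε (φ x) ∂ν := by
  have hφμ : ∀ μ ∈ (Matrix.finite_spectrum A).toFinset,
      ContinuousOn (Function.uncurry φ) (K ×ˢ Metric.sphere μ ε) := fun μ hμ =>
    hφ.mono (prod_mono_right (sphere_subset_contour ((Matrix.finite_spectrum A).mem_toFinset.1 hμ)))
  simp only [contourIntegral]
  rw [integral_const_mul, integral_finsetSum _ fun μ hμ =>
    integrableOn_circleIntegral hK hε (hφμ μ hμ)]
  exact congrArg _ (Finset.sum_congr rfl fun μ hμ => circleIntegral_setIntegral hK hε (hφμ μ hμ))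

end Contour

section FunctionalCalculus

open Matrix

variable {n : ℕ} {A : Matrix (Fin n) (Fin n) ℂ} {V : Set ℂ} {ε : ℝ} {f g : ℂ → ℂ}

theorem exists_isContourRadius_of_analyticOnNhd (hf : AnalyticOnNhd ℂ f (spectrum ℂ A)) :
    ∃ ε, IsContourRadius A {w | AnalyticAt ℂ f w} ε :=
  exists_isContourRadius (isOpen_analyticAt ℂ f) hf

theorem IsContourRadius.isAdmissibleRadius (hε : IsContourRadius A V ε)
    (hf : AnalyticOnNhd ℂ f V) : IsAdmissibleRadius f A ε :=
  ⟨hε.pos, hε.disjoint, fun μ hμ => hf.mono (hε.closedBall_subset μ hμ)⟩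

theorem IsContourRadius.matFun_apply (hε : IsContourRadius A V ε) (hf : AnalyticOnNhd ℂ f V)
    (i j : Fin n) :
    matFun f A i j = contourIntegral A ε fun w => f w * (w • 1 - A)⁻¹ i j := by
  rw [matFun_eq_cauchyMatrix (hε.isAdmissibleRadius hf)]
  rfl

theorem isUnit_sub_of_notMem_spectrum {w : ℂ} (hw : w ∉ spectrum ℂ A) : IsUnit (w • 1 - A) := by
  rwa [spectrum.notMem_iff, Algebra.algebraMap_eq_smul_one] at hw

theorem IsContourRadius.continuousOn_resolvent (hε : IsContourRadius A V ε) (i j : Fin n) :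
    ContinuousOn (fun w : ℂ => (w • 1 - A)⁻¹ i j) (contour A ε) := fun _ hw =>
  (differentiableAt_resolvent_entry i j
    (hε.notMem_spectrum hw)).continuousAt.continuousWithinAt

theorem IsContourRadius.continuousOn_mul_resolvent (hε : IsContourRadius A V ε)
    (hf : AnalyticOnNhd ℂ f V) (i j : Fin n) :
    ContinuousOn (fun w => f w * (w • 1 - A)⁻¹ i j) (contour A ε) :=
  (hf.continuousOn.mono hε.contour_subset).mul (hε.continuousOn_resolvent i j)

theorem matFun_congr (hV : IsOpen V) (hA : spectrum ℂ A ⊆ V) (hf : AnalyticOnNhd ℂ f V)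
    (h : EqOn f g V) : matFun f A = matFun g A := by
  obtain ⟨ε, hε⟩ := exists_isContourRadius hV hA
  ext i j
  rw [hε.matFun_apply hf, hε.matFun_apply (hf.congr hV h)]
  exact contourIntegral_congr hε.pos.le fun w hw => by simp only [h (hε.contour_subset hw)]

theorem matFun_add (hf : AnalyticOnNhd ℂ f (spectrum ℂ A))
    (hg : AnalyticOnNhd ℂ g (spectrum ℂ A)) :
    matFun (fun w => f w + g w) A = matFun f A + matFun g A := by
  obtain ⟨ε, hε⟩ := exists_isContourRadius
    ((isOpen_analyticAt ℂ f).inter (isOpen_analyticAt ℂ g)) (subset_inter hf hg)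
  have hf' : AnalyticOnNhd ℂ f ({w | AnalyticAt ℂ f w} ∩ {w | AnalyticAt ℂ g w}) := fun _ h => h.1
  have hg' : AnalyticOnNhd ℂ g ({w | AnalyticAt ℂ f w} ∩ {w | AnalyticAt ℂ g w}) := fun _ h => h.2
  ext i j
  simp only [Matrix.add_apply, hε.matFun_apply hf', hε.matFun_apply hg',
    hε.matFun_apply (f := fun w => f w + g w) (hf'.add hg'), add_mul]
  exact contourIntegral_add hε.pos.le (hε.continuousOn_mul_resolvent hf' i j)
    (hε.continuousOn_mul_resolvent hg' i j)

theorem matFun_const_mul (hf : AnalyticOnNhd ℂ f (spectrum ℂ A)) (c : ℂ) :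
    matFun (fun w => c * f w) A = c • matFun f A := by
  obtain ⟨ε, hε⟩ := exists_isContourRadius_of_analyticOnNhd hf
  have hf' : AnalyticOnNhd ℂ f {w | AnalyticAt ℂ f w} := fun _ h => h
  ext i j
  rw [Matrix.smul_apply, hε.matFun_apply hf',
    hε.matFun_apply (f := fun w => c * f w) (analyticOnNhd_const.mul hf')]
  simp only [mul_assoc, contourIntegral_const_mul, smul_eq_mul]

theorem matFun_sub (hf : AnalyticOnNhd ℂ f (spectrum ℂ A))
    (hg : AnalyticOnNhd ℂ g (spectrum ℂ A)) :
    matFun (fun w => f w - g w) A = matFun f A - matFun g A := by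
  have h := matFun_add (f := fun w => f w - g w) (hf.sub hg) hg
  simp only [sub_add_cancel] at h
  exact eq_sub_of_add_eq h.symm

theorem mul_resolvent {w : ℂ} (hw : w ∉ spectrum ℂ A) :
    A * (w • 1 - A)⁻¹ = w • (w • 1 - A)⁻¹ - 1 := by
  have h := Matrix.mul_nonsing_inv _
    ((Matrix.isUnit_iff_isUnit_det _).1 (isUnit_sub_of_notMem_spectrum hw))
  rw [sub_mul, smul_mul_assoc, one_mul] at h
  rw [eq_sub_iff_add_eq, ← eq_sub_iff_add_eq', h]

theorem matFun_id_mul (hf : AnalyticOnNhd ℂ f (spectrum ℂ A)) :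
    matFun (fun w => w * f w) A = A * matFun f A := by
  obtain ⟨ε, hε⟩ := exists_isContourRadius_of_analyticOnNhd hf
  have hf' : AnalyticOnNhd ℂ f {w | AnalyticAt ℂ f w} := fun _ h => h
  have hcont := hε.continuousOn_mul_resolvent hf'
  ext i j
  calc matFun (fun w => w * f w) A i j
    _ = contourIntegral A ε fun w => w * f w * (w • 1 - A)⁻¹ i j :=
      hε.matFun_apply (analyticOnNhd_id.mul hf') i j
    _ = contourIntegral A ε fun w => ∑ k, A i k * (f w * (w • 1 - A)⁻¹ k j) +
          (1 : Matrix (Fin n) (Fin n) ℂ) i j * f w := by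
      refine contourIntegral_congr hε.pos.le fun w hw => ?_
      have h : ∑ k, A i k * (w • 1 - A)⁻¹ k j =
          w * (w • 1 - A)⁻¹ i j - (1 : Matrix (Fin n) (Fin n) ℂ) i j := by
        simpa [Matrix.mul_apply] using
          congrFun (congrFun (mul_resolvent (hε.notMem_spectrum hw)) i) j
      simp only [mul_left_comm (A i _), ← Finset.mul_sum, h]
      ring
    _ = ∑ k, A i k * matFun f A k j := by
      rw [contourIntegral_add hε.pos.le
          (continuousOn_finsetSum _ fun k _ => continuousOn_const.fun_mul (hcont k j))
          (continuousOn_const.fun_mul (hf'.continuousOn.mono hε.contour_subset)),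
        contourIntegral_const_mul, contourIntegral_eq_zero hε hf', mul_zero, add_zero,
        contourIntegral_sum hε.pos.le _ fun k _ => continuousOn_const.fun_mul (hcont k j)]
      simp only [contourIntegral_const_mul, hε.matFun_apply hf']
    _ = (A * matFun f A) i j := (Matrix.mul_apply ..).symm

theorem matFun_eval_mul (hf : AnalyticOnNhd ℂ f (spectrum ℂ A)) (p : ℂ[X]) :
    matFun (fun w => p.eval w * f w) A = Polynomial.aeval A p * matFun f A := by
  have han (q : ℂ[X]) : AnalyticOnNhd ℂ (fun w => q.eval w * f w) (spectrum ℂ A) :=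
    fun μ hμ => (analyticAt_eval q μ).mul (hf μ hμ)
  induction p using Polynomial.induction_on with
  | C a => simp [matFun_const_mul hf, Algebra.algebraMap_eq_smul_one]
  | add p q hp hq =>
    simp only [Polynomial.eval_add, add_mul, map_add, ← hp, ← hq]
    exact matFun_add (han p) (han q)
  | monomial k a ih =>
    have h := matFun_id_mul (han (Polynomial.C a * Polynomial.X ^ k))
    rw [ih, ← mul_assoc] at h
    rw [show Polynomial.C a * Polynomial.X ^ (k + 1)
      = Polynomial.X * (Polynomial.C a * Polynomial.X ^ k) by ring]
    simpa [mul_assoc] using h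

theorem resolvent_mulVec {w μ : ℂ} (hw : w ∉ spectrum ℂ A) (hwμ : w ≠ μ) (x : Fin n → ℂ) :
    (w • 1 - A)⁻¹ *ᵥ x =
      (w - μ)⁻¹ • (x + (w • 1 - A)⁻¹ *ᵥ ((A - μ • 1) *ᵥ x)) := by
  have hu := (Matrix.isUnit_iff_isUnit_det _).1 (isUnit_sub_of_notMem_spectrum hw)
  have h : (w • 1 - A) *ᵥ x + (A - μ • 1) *ᵥ x = (w - μ) • x := by
    rw [← Matrix.add_mulVec, sub_add_sub_cancel, ← sub_smul, Matrix.smul_mulVec, Matrix.one_mulVec]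
  rw [eq_inv_smul_iff₀ (sub_ne_zero.2 hwμ), ← Matrix.mulVec_smul, ← h, Matrix.mulVec_add,
    Matrix.mulVec_mulVec, Matrix.nonsing_inv_mul _ hu, Matrix.one_mulVec]

/-- The case `m = 0` says that the spectral projections of `A` add up to the identity on the
generalized eigenspaces; the induction on the nilpotency index needs all `m`. -/
theorem contourIntegral_zpow_mul_resolvent_mulVec (hε : IsContourRadius A V ε) {μ : ℂ}
    (hμ : μ ∈ spectrum ℂ A) {k : ℕ} {x : Fin n → ℂ} (hx : (A - μ • 1) ^ k *ᵥ x = 0) (m : ℕ)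
    (i : Fin n) :
    contourIntegral A ε (fun w => (w - μ) ^ (-m : ℤ) * ((w • 1 - A)⁻¹ *ᵥ x) i) =
      if m = 0 then x i else 0 := by
  induction k generalizing x m with
  | zero =>
    obtain rfl : x = 0 := by simpa using hx
    simpa using contourIntegral_const_mul (A := A) (ε := ε) 0 0
  | succ k ih =>
    rw [pow_succ, ← Matrix.mulVec_mulVec] at hx
    have hz := hε.continuousOn_sub_zpow hμ (-(m + 1 : ℕ))
    have hR : ContinuousOn (fun w : ℂ => ((w • 1 - A)⁻¹ *ᵥ ((A - μ • 1) *ᵥ x)) i)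
        (contour A ε) := by
      simp only [Matrix.mulVec, dotProduct]
      exact continuousOn_finsetSum _ fun j _ =>
        (hε.continuousOn_resolvent i j).fun_mul continuousOn_const
    calc contourIntegral A ε (fun w => (w - μ) ^ (-m : ℤ) * ((w • 1 - A)⁻¹ *ᵥ x) i)
      _ = contourIntegral A ε (fun w => x i * (w - μ) ^ (-(m + 1 : ℕ) : ℤ) +
            (w - μ) ^ (-(m + 1 : ℕ) : ℤ) * ((w • 1 - A)⁻¹ *ᵥ ((A - μ • 1) *ᵥ x)) i) := by
        refine contourIntegral_congr hε.pos.le fun w hw => ?_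
        have hwA := hε.notMem_spectrum hw
        have hwμ : w ≠ μ := fun h => hwA (h ▸ hμ)
        have hpow : (w - μ) ^ (-(m + 1 : ℕ) : ℤ) = (w - μ) ^ (-m : ℤ) * (w - μ)⁻¹ := by
          rw [← zpow_sub_one₀ (sub_ne_zero.2 hwμ)]
          congr 1
          push_cast
          ring
        simp only [resolvent_mulVec hwA hwμ x, Pi.smul_apply, Pi.add_apply, smul_eq_mul, hpow]
        ring
      _ = x i * (if m = 0 then 1 else 0) := by
        rw [contourIntegral_add hε.pos.le (continuousOn_const.fun_mul hz) (hz.fun_mul hR), ih hx,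
          contourIntegral_const_mul, contourIntegral_sub_zpow hε hμ, if_neg (Nat.succ_ne_zero m),
          add_zero]
        congr 2
        simp
      _ = if m = 0 then x i else 0 := by rw [mul_ite, mul_one, mul_zero]

theorem matFun_one_mulVec {μ : ℂ} (hμ : μ ∈ spectrum ℂ A) {k : ℕ} {x : Fin n → ℂ}
    (hx : (A - μ • 1) ^ k *ᵥ x = 0) : matFun (fun _ => 1) A *ᵥ x = x := by
  obtain ⟨ε, hε⟩ := exists_isContourRadius isOpen_univ (subset_univ (spectrum ℂ A))
  ext i
  have h := contourIntegral_zpow_mul_resolvent_mulVec hε hμ hx 0 i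
  simp only [Matrix.mulVec, dotProduct, Nat.cast_zero, neg_zero, zpow_zero, one_mul,
    if_true, mul_comm _ (x _)] at h
  rw [contourIntegral_sum hε.pos.le _ fun j _ =>
    continuousOn_const.fun_mul (hε.continuousOn_resolvent i j)] at h
  simp only [contourIntegral_const_mul] at h
  simpa only [Matrix.mulVec, dotProduct, hε.matFun_apply analyticOnNhd_const, one_mul,
    mul_comm _ (x _)] using h

theorem eq_zero_of_pow_sub_mulVec_eq_zero {μ : ℂ} (hμ : μ ∉ spectrum ℂ A) {k : ℕ}
    {x : Fin n → ℂ} (hx : (A - μ • 1) ^ k *ᵥ x = 0) : x = 0 := by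
  have hu : IsUnit ((A - μ • 1) ^ k) := by
    simpa using (isUnit_sub_of_notMem_spectrum hμ).neg.pow k
  exact Matrix.mulVec_injective_of_isUnit hu (hx.trans (Matrix.mulVec_zero _).symm)

theorem matFun_one : matFun (fun _ => 1) A = 1 := by
  suffices h : ⊤ ≤ LinearMap.eqLocus (Matrix.toLin' (matFun (fun _ => 1) A)) LinearMap.id by
    apply Matrix.toLin'.injective
    rw [Matrix.toLin'_one]
    exact LinearMap.eqLocus_eq_top.1 (top_le_iff.1 h)
  rw [← Module.End.iSup_maxGenEigenspace_eq_top (Matrix.toLin' A)]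
  refine iSup_le fun μ x hx => ?_
  obtain ⟨k, hk⟩ := (Module.End.mem_maxGenEigenspace _ _ _).1 hx
  have hxk : (A - μ • 1) ^ k *ᵥ x = 0 := by
    rw [← hk, ← Matrix.toLin'_apply, Matrix.toLin'_pow, map_sub, map_smul, Matrix.toLin'_one]
    rfl
  rw [LinearMap.mem_eqLocus, Matrix.toLin'_apply, LinearMap.id_apply]
  by_cases hμ : μ ∈ spectrum ℂ A
  · exact matFun_one_mulVec hμ hxk
  · rw [eq_zero_of_pow_sub_mulVec_eq_zero hμ hxk, Matrix.mulVec_zero]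

theorem matFun_eval (p : ℂ[X]) : matFun (fun w => p.eval w) A = Polynomial.aeval A p := by
  simpa [matFun_one] using matFun_eval_mul (A := A) (f := fun _ => 1) analyticOnNhd_const p

end FunctionalCalculus

section PolynomialSubstitution

variable {n : ℕ} {A : Matrix (Fin n) (Fin n) ℂ} {S : Set ℂ} {g : ℂ → ℂ}

theorem analyticAt_dslope {a b : ℂ} (hb : AnalyticAt ℂ g b) :
    AnalyticAt ℂ (dslope g a) b := by
  rcases eq_or_ne b a with rfl | hne
  · obtain ⟨p, hp⟩ := hb
    exact hp.has_fpower_series_dslope_fslope.analyticAt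
  · refine AnalyticAt.congr ?_ (dslope_eventuallyEq_slope_of_ne g hne).symm
    have hinv : AnalyticAt ℂ (fun w => (w - a)⁻¹) b :=
      (analyticAt_id.sub analyticAt_const).inv (sub_ne_zero.2 hne)
    exact hinv.smul (hb.sub analyticAt_const)

theorem exists_eq_eval_add_eval_mul (hg : AnalyticOnNhd ℂ g S) (s : Multiset ℂ) :
    ∃ (p : ℂ[X]) (k : ℂ → ℂ), AnalyticOnNhd ℂ k S ∧
      ∀ w, g w = p.eval w + (s.map fun a => Polynomial.X - Polynomial.C a).prod.eval w * k w := by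
  induction s using Multiset.induction_on with
  | empty => exact ⟨0, g, hg, fun w => by simp⟩
  | cons a s ih =>
    obtain ⟨p, k, hk, hgk⟩ := ih
    set q := (s.map fun a => Polynomial.X - Polynomial.C a).prod
    refine ⟨p + q * Polynomial.C (k a), dslope k a, fun b hb => analyticAt_dslope (hk b hb),
      fun w => ?_⟩
    have hkw : k w = k a + (w - a) * dslope k a w := by
      rw [← smul_eq_mul, sub_smul_dslope, add_sub_cancel]
    simp only [hgk w, Multiset.map_cons, Multiset.prod_cons, Polynomial.eval_add,
      Polynomial.eval_mul, Polynomial.eval_sub, Polynomial.eval_X, Polynomial.eval_C]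
    linear_combination q.eval w * hkw

theorem matFun_eval_add_eval_mul {k : ℂ → ℂ} (hk : AnalyticOnNhd ℂ k (spectrum ℂ A))
    (p q : ℂ[X]) :
    matFun (fun w => p.eval w + q.eval w * k w) A =
      Polynomial.aeval A p + Polynomial.aeval A q * matFun k A := by
  have hqk : AnalyticOnNhd ℂ (fun w => q.eval w * k w) (spectrum ℂ A) := fun μ hμ =>
    (analyticAt_eval q μ).mul (hk μ hμ)
  rw [matFun_add (analyticOnNhd_eval p _) hqk, matFun_eval,
    matFun_eval_mul hk]

theorem spectrum_aeval_subset (p : ℂ[X]) :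
    spectrum ℂ (Polynomial.aeval A p) ⊆ p.eval '' spectrum ℂ A := by
  rcases isEmpty_or_nonempty (Fin n) with h | h
  · simp [spectrum.of_subsingleton]
  · exact (spectrum.map_polynomial_aeval_of_nonempty A p
      (spectrum.nonempty_of_isAlgClosed_of_finiteDimensional ℂ A)).subset

theorem isUnit_aeval_of_eval_ne_zero {p : ℂ[X]} (hp : ∀ μ ∈ spectrum ℂ A, p.eval μ ≠ 0) :
    IsUnit (Polynomial.aeval A p) := by
  refine spectrum.isUnit_of_zero_notMem ℂ fun h => ?_
  obtain ⟨μ, hμ, h0⟩ := spectrum_aeval_subset p h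
  exact hp μ hμ h0

/-- On the spectrum of `p(A)`, `g` is a polynomial plus a multiple of the characteristic polynomial
of `p(A)`; the multiple is killed on both sides. -/
theorem matFun_aeval (p : ℂ[X]) (hg : AnalyticOnNhd ℂ g (p.eval '' spectrum ℂ A)) :
    matFun g (Polynomial.aeval A p) = matFun (fun w => g (p.eval w)) A := by
  set χ := (Polynomial.aeval A p).charpoly
  have hχ : Polynomial.aeval (Polynomial.aeval A p) χ = 0 := Matrix.aeval_self_charpoly _
  obtain ⟨q, k, hk, hgk⟩ := exists_eq_eval_add_eval_mul hg χ.roots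
  rw [← (IsAlgClosed.splits χ).eq_prod_roots_of_monic (Matrix.charpoly_monic _)] at hgk
  have hkp : AnalyticOnNhd ℂ (fun w => k (p.eval w)) (spectrum ℂ A) := fun μ hμ =>
    AnalyticAt.comp (f := fun w => p.eval w) (hk _ (mem_image_of_mem _ hμ))
      (analyticAt_eval p μ)
  calc matFun g (Polynomial.aeval A p)
    _ = Polynomial.aeval (Polynomial.aeval A p) q := by
      rw [funext hgk, matFun_eval_add_eval_mul (hk.mono (spectrum_aeval_subset p)), hχ, zero_mul,
        add_zero]
    _ = matFun (fun w => (q.comp p).eval w + (χ.comp p).eval w * k (p.eval w)) A := by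
      rw [matFun_eval_add_eval_mul hkp, Polynomial.aeval_comp, Polynomial.aeval_comp, hχ, zero_mul,
        add_zero]
    _ = matFun (fun w => g (p.eval w)) A := by simp only [Polynomial.eval_comp, hgk]

end PolynomialSubstitution

section Parameters

variable {n : ℕ} {A : Matrix (Fin n) (Fin n) ℂ} {V : Set ℂ} {ε : ℝ}
  {X : Type*} [TopologicalSpace X] {K : Set X} {F : X → ℂ → ℂ}

theorem continuousOn_contourIntegral (hε : 0 ≤ ε)
    (hF : ContinuousOn (Function.uncurry F) (K ×ˢ contour A ε)) :
    ContinuousOn (fun x => contourIntegral A ε (F x)) K := by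
  rw [continuousOn_iff_continuous_domRestrict]
  refine continuous_const.mul (continuous_finsetSum _ fun μ hμ => ?_)
  refine intervalIntegral.continuous_parametric_intervalIntegral_of_continuous' ?_ _ _
  have hcirc : Continuous fun p : K × ℝ => F p.1 (circleMap μ ε p.2) :=
    hF.comp_continuous (f := fun p : K × ℝ => ((p.1 : X), circleMap μ ε p.2)) (by fun_prop)
      fun p => ⟨p.1.2, sphere_subset_contour ((Matrix.finite_spectrum A).mem_toFinset.1 hμ)
        (circleMap_mem_sphere μ hε p.2)⟩
  simp only [deriv_circleMap, Function.uncurry_def]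
  exact (((continuous_circleMap 0 ε).comp continuous_snd).mul continuous_const).smul hcirc

theorem IsContourRadius.continuousOn_uncurry_mul_resolvent (hε : IsContourRadius A V ε)
    (hF : ContinuousOn (Function.uncurry F) (K ×ˢ V)) (i j : Fin n) :
    ContinuousOn (Function.uncurry fun x w => F x w * (w • 1 - A)⁻¹ i j)
      (K ×ˢ contour A ε) :=
  (hF.mono (prod_mono_right hε.contour_subset)).mul
    ((hε.continuousOn_resolvent i j).comp continuousOn_snd fun _ hp => hp.2)

theorem continuousOn_matFun (hV : IsOpen V) (hA : spectrum ℂ A ⊆ V)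
    (hF : ContinuousOn (Function.uncurry F) (K ×ˢ V)) (hFa : ∀ x ∈ K, AnalyticOnNhd ℂ (F x) V) :
    ContinuousOn (fun x => matFun (F x) A) K := by
  obtain ⟨ε, hε⟩ := exists_isContourRadius hV hA
  refine continuousOn_pi.2 fun i => continuousOn_pi.2 fun j => ?_
  exact (continuousOn_contourIntegral hε.pos.le
    (hε.continuousOn_uncurry_mul_resolvent hF i j)).congr
      fun x hx => hε.matFun_apply (hFa x hx) i j

variable [T2Space X] [MeasurableSpace X] [BorelSpace X] {ν : Measure X}
  [IsFiniteMeasureOnCompacts ν] [SFinite ν]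

theorem analyticOnNhd_setIntegral (hK : IsCompact K) (hV : IsOpen V)
    (hF : ContinuousOn (Function.uncurry F) (K ×ˢ V)) (hFa : ∀ x ∈ K, AnalyticOnNhd ℂ (F x) V) :
    AnalyticOnNhd ℂ (fun w => ∫ x in K, F x w ∂ν) V := by
  intro c hc
  obtain ⟨R, hR, hRV⟩ := Metric.nhds_basis_closedBall.mem_iff.1 (hV.mem_nhds hc)
  lift R to NNReal using hR.le
  have hFs : ContinuousOn (Function.uncurry F) (K ×ˢ Metric.sphere c R) :=
    hF.mono (prod_mono_right (Metric.sphere_subset_closedBall.trans hRV))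
  refine (hasFPowerSeriesOn_cauchy_integral (circleIntegrable_setIntegral (ν := ν) hK hR.le hFs)
    (NNReal.coe_pos.1 hR)).analyticAt.congr ?_
  filter_upwards [Metric.ball_mem_nhds c hR] with w hw
  have hinv : ContinuousOn (fun z => (z - w)⁻¹) (Metric.sphere c R) :=
    (continuousOn_id.sub continuousOn_const).inv₀ fun z hz h =>
      Metric.sphere_disjoint_ball.ne_of_mem hz hw (sub_eq_zero.1 h)
  have hker : ContinuousOn (Function.uncurry fun x z => (z - w)⁻¹ • F x z)
      (K ×ˢ Metric.sphere c R) := (hinv.comp continuousOn_snd fun _ hp => hp.2).smul hFs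
  calc (2 * Real.pi * I : ℂ)⁻¹ • ∮ z in C(c, R), (z - w)⁻¹ • ∫ x in K, F x z ∂ν
    _ = ∫ x in K, (2 * Real.pi * I : ℂ)⁻¹ • ∮ z in C(c, R), (z - w)⁻¹ • F x z ∂ν := by
      simp only [← integral_smul]
      rw [circleIntegral_setIntegral hK hR.le hker, integral_smul]
    _ = ∫ x in K, F x w ∂ν := by
      refine setIntegral_congr_fun hK.measurableSet fun x hx => ?_
      exact two_pi_I_inv_smul_circleIntegral_sub_inv_smul_of_differentiable_on_off_countable
        countable_empty hw ((hFa x hx).continuousOn.mono hRV)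
        fun z hz => (hFa x hx z (hRV (Metric.ball_subset_closedBall hz.1))).differentiableAt

theorem matFun_setIntegral_apply (hK : IsCompact K) (hV : IsOpen V) (hA : spectrum ℂ A ⊆ V)
    (hF : ContinuousOn (Function.uncurry F) (K ×ˢ V)) (hFa : ∀ x ∈ K, AnalyticOnNhd ℂ (F x) V)
    (i j : Fin n) :
    matFun (fun w => ∫ x in K, F x w ∂ν) A i j = ∫ x in K, matFun (F x) A i j ∂ν := by
  obtain ⟨ε, hε⟩ := exists_isContourRadius hV hA
  rw [hε.matFun_apply (analyticOnNhd_setIntegral hK hV hF hFa),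
    setIntegral_congr_fun hK.measurableSet fun x hx => hε.matFun_apply (hFa x hx) i j,
    ← contourIntegral_setIntegral hε.pos.le hK (hε.continuousOn_uncurry_mul_resolvent hF i j)]
  simp only [integral_mul_const]

end Parameters

section Simplices

variable {N : ℕ} {s : ℝ}

/-- The simplex `s ≥ t_1 ≥ … ≥ t_N ≥ 0`, the domain of integration of `iterIntegral N F s`; it is
`orderedSimplex N` when `s = 1`. -/
def scaledSimplex (N : ℕ) (s : ℝ) : Set (Fin N → ℝ) :=
  {t | Antitone t ∧ ∀ k, t k ∈ Icc 0 s}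

theorem isCompact_scaledSimplex (N : ℕ) (s : ℝ) : IsCompact (scaledSimplex N s) := by
  refine (isCompact_Icc (a := (0 : Fin N → ℝ)) (b := fun _ => s)).of_isClosed_subset ?_
    fun t ht => ⟨fun k => (ht.2 k).1, fun k => (ht.2 k).2⟩
  simp only [scaledSimplex, Antitone, ofPred_and, ofPred_forall]
  exact (isClosed_iInter fun i => isClosed_iInter fun j => isClosed_iInter fun _ =>
    isClosed_le (continuous_apply j) (continuous_apply i)).inter
      (isClosed_iInter fun i => isClosed_Icc.preimage (continuous_apply i))

theorem cons_mem_scaledSimplex_iff {x : ℝ} {t : Fin N → ℝ} :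
    (Fin.cons x t : Fin (N + 1) → ℝ) ∈ scaledSimplex (N + 1) s ↔
      x ∈ Icc 0 s ∧ t ∈ scaledSimplex N x := by
  constructor
  · intro ⟨hanti, hmem⟩
    refine ⟨by simpa using hmem 0, fun i j hij => ?_, fun k => ?_⟩
    · simpa using hanti (Fin.succ_le_succ_iff.2 hij)
    · exact ⟨by simpa using (hmem k.succ).1, by simpa using hanti (Fin.zero_le k.succ)⟩
  · intro ⟨hx, hanti, hmem⟩
    refine ⟨?_, fun k => ?_⟩
    · intro i j hij
      cases i using Fin.cases with
      | zero =>
        cases j using Fin.cases with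
        | zero => rfl
        | succ j => simpa using (hmem j).2
      | succ i =>
        cases j using Fin.cases with
        | zero => simp at hij
        | succ j => simpa using hanti (Fin.succ_le_succ_iff.1 hij)
    · cases k using Fin.cases with
      | zero => simpa using hx
      | succ k => simpa using ⟨(hmem k).1, (hmem k).2.trans hx.2⟩

theorem iterIntegral_congr {F G : (Fin N → ℝ) → ℂ} (hs : 0 ≤ s)
    (h : EqOn F G (scaledSimplex N s)) : iterIntegral N F s = iterIntegral N G s := by
  induction N generalizing s with
  | zero => exact h ⟨fun i => i.elim0, fun k => k.elim0⟩
  | succ N ih =>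
    refine intervalIntegral.integral_congr fun x hx => ?_
    rw [uIcc_of_le hs] at hx
    exact ih hx.1 fun t ht => h (cons_mem_scaledSimplex_iff.2 ⟨hx, ht⟩)

theorem iterIntegral_const_mul (c : ℂ) (F : (Fin N → ℝ) → ℂ) (s : ℝ) :
    iterIntegral N (fun t => c * F t) s = c * iterIntegral N F s := by
  induction N generalizing s with
  | zero => rfl
  | succ N ih => simp only [iterIntegral, ih, intervalIntegral.integral_const_mul]

theorem setIntegral_scaledSimplex_succ {F : (Fin (N + 1) → ℝ) → ℂ}
    (hF : ContinuousOn F (scaledSimplex (N + 1) s)) :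
    ∫ t in scaledSimplex (N + 1) s, F t =
      ∫ x in Icc 0 s, ∫ t in scaledSimplex N x, F (Fin.cons x t) := by
  have hmeas := fun M r => (isCompact_scaledSimplex M r).measurableSet
  have hmp := (volume_preserving_piFinSuccAbove (fun _ : Fin (N + 1) => ℝ) 0).symm
  set e := (MeasurableEquiv.piFinSuccAbove (fun _ : Fin (N + 1) => ℝ) 0).symm
  have he : ∀ x t, e (x, t) = (Fin.cons x t : Fin (N + 1) → ℝ) := fun x t => Fin.insertNth_zero' x t
  rw [← integral_indicator (hmeas _ _), ← hmp.integral_comp e.measurableEmbedding,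
    Measure.volume_eq_prod, integral_prod, ← integral_indicator measurableSet_Icc]
  · refine integral_congr_ae (ae_of_all _ fun x => ?_)
    classical
    by_cases hx : x ∈ Icc 0 s
    · simp only [he, indicator_of_mem hx, ← integral_indicator (hmeas N x), indicator_apply,
        cons_mem_scaledSimplex_iff, hx, true_and]
    · simp only [he, indicator_apply, cons_mem_scaledSimplex_iff, hx, false_and, if_false,
        integral_zero]
  · exact (hmp.integrable_comp_emb e.measurableEmbedding).2
      ((hF.integrableOn_compact (isCompact_scaledSimplex _ _)).integrable_indicator (hmeas _ _))

theorem iterIntegral_eq_setIntegral {F : (Fin N → ℝ) → ℂ} (hs : 0 ≤ s)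
    (hF : ContinuousOn F (scaledSimplex N s)) :
    iterIntegral N F s = ∫ t in scaledSimplex N s, F t := by
  induction N generalizing s with
  | zero =>
    have huniv : scaledSimplex 0 s = univ :=
      eq_univ_of_forall fun t => ⟨fun i => i.elim0, fun k => k.elim0⟩
    rw [huniv, setIntegral_univ, Measure.volume_pi_eq_dirac, integral_dirac]
    rfl
  | succ N ih =>
    rw [setIntegral_scaledSimplex_succ hF, integral_Icc_eq_integral_Ioc,
      ← intervalIntegral.integral_of_le hs]
    refine intervalIntegral.integral_congr fun x hx => ?_
    rw [uIcc_of_le hs] at hx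
    exact ih hx.1 (hF.comp (by fun_prop) fun t ht => cons_mem_scaledSimplex_iff.2 ⟨hx, ht⟩)

theorem iterIntegral_sub {F G : (Fin N → ℝ) → ℂ} (hs : 0 ≤ s)
    (hF : ContinuousOn F (scaledSimplex N s)) (hG : ContinuousOn G (scaledSimplex N s)) :
    iterIntegral N (fun t => F t - G t) s = iterIntegral N F s - iterIntegral N G s := by
  have hK := isCompact_scaledSimplex N s
  rw [iterIntegral_eq_setIntegral hs hF, iterIntegral_eq_setIntegral hs hG,
    iterIntegral_eq_setIntegral hs (hF.fun_sub hG)]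
  exact integral_sub (hF.integrableOn_compact hK) (hG.integrableOn_compact hK)

theorem iterIntegral_succ_last (F : (Fin (N + 1) → ℝ) → ℂ) (s : ℝ) :
    iterIntegral (N + 1) F s = iterIntegral N
      (fun t => ∫ x in (0 : ℝ)..(Fin.cons s t : Fin (N + 1) → ℝ) (Fin.last N),
        F (Fin.snoc t x)) s := by
  induction N generalizing s with
  | zero =>
    simp only [iterIntegral]
    refine intervalIntegral.integral_congr fun t _ => ?_
    congr 1
    ext i
    fin_cases i
    simp [Fin.snoc]
  | succ N ih =>
    rw [iterIntegral]
    refine intervalIntegral.integral_congr fun t _ => ?_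
    simp only [ih]
    congr 1
    ext τ
    rw [← Fin.succ_last, Fin.cons_succ]
    simp only [← Fin.cons_snoc_eq_snoc_cons]

end Simplices

section NodeSegments

variable {N : ℕ} {V : Set ℂ}

/-- The last parameter `t_N` of a point of the simplex, where `t_0 = 1`: the coefficient of `A` in
`nodeMatrix z A t`. -/
noncomputable def lastParam (t : Fin N → ℝ) : ℝ :=
  (Fin.cons 1 t : Fin (N + 1) → ℝ) (Fin.last N)

/-- The part `(1 - t_1) z_1 + (t_1 - t_2) z_2 + … + (t_{N-1} - t_N) z_N` of `nodeMatrix z A t` that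
does not depend on `A`. -/
noncomputable def nodeCenter (z : Fin N → ℂ) (t : Fin N → ℝ) : ℂ :=
  ∑ k : Fin N, (((Fin.cons 1 t : Fin (N + 1) → ℝ) k.castSucc
    - (Fin.cons 1 t : Fin (N + 1) → ℝ) k.succ : ℝ) : ℂ) * z k

/-- The polynomial of degree at most one whose value at `A` is `nodeMatrix z A t`, so that a
function of `nodeMatrix z A t` becomes a function of `A`. -/
noncomputable def nodeAffine (z : Fin N → ℂ) (t : Fin N → ℝ) : ℂ[X] :=
  Polynomial.C (nodeCenter z t) + Polynomial.C (lastParam t : ℂ) * Polynomial.X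

theorem eval_nodeAffine (z : Fin N → ℂ) (t : Fin N → ℝ) (w : ℂ) :
    (nodeAffine z t).eval w = nodeCenter z t + lastParam t * w := by
  simp only [nodeAffine, Polynomial.eval_add, Polynomial.eval_mul, Polynomial.eval_C,
    Polynomial.eval_X]

theorem aeval_nodeAffine {n : ℕ} (z : Fin N → ℂ) (A : Matrix (Fin n) (Fin n) ℂ)
    (t : Fin N → ℝ) : Polynomial.aeval A (nodeAffine z t) = nodeMatrix z A t := by
  simp only [nodeAffine, nodeMatrix, nodeCenter, lastParam, map_add, map_mul, Polynomial.aeval_C,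
    Polynomial.aeval_X, Algebra.algebraMap_eq_smul_one, Finset.sum_smul, smul_smul, smul_mul_assoc,
    one_mul]

theorem continuous_eval_nodeAffine (z : Fin N → ℂ) :
    Continuous fun p : (Fin N → ℝ) × ℂ => (nodeAffine z p.1).eval p.2 := by
  simp only [eval_nodeAffine, nodeCenter, lastParam]
  fun_prop

theorem lastParam_snoc (t : Fin N → ℝ) (x : ℝ) :
    lastParam (Fin.snoc t x : Fin (N + 1) → ℝ) = x := by
  rw [lastParam, Fin.cons_snoc_eq_snoc_cons, Fin.snoc_last]

theorem nodeCenter_snoc (z : Fin (N + 1) → ℂ) (t : Fin N → ℝ) (x : ℝ) :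
    nodeCenter z (Fin.snoc t x : Fin (N + 1) → ℝ) =
      nodeCenter (Fin.init z) t + (lastParam t - x) * z (Fin.last N) := by
  simp only [nodeCenter, lastParam, Fin.cons_snoc_eq_snoc_cons, Fin.sum_univ_castSucc,
    Fin.succ_castSucc, Fin.snoc_castSucc, Fin.succ_last, Fin.snoc_last, ofReal_sub, Fin.init]

theorem eval_nodeAffine_snoc (z : Fin (N + 1) → ℂ) (t : Fin N → ℝ) (x : ℝ) (w : ℂ) :
    (nodeAffine z (Fin.snoc t x : Fin (N + 1) → ℝ)).eval w =
      (nodeAffine (Fin.init z) t).eval (z (Fin.last N)) + x * (w - z (Fin.last N)) := by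
  rw [eval_nodeAffine, eval_nodeAffine, nodeCenter_snoc, lastParam_snoc]
  ring

theorem eval_nodeAffine_eq_add (z : Fin N → ℂ) (t : Fin N → ℝ) (b w : ℂ) :
    (nodeAffine z t).eval w = (nodeAffine z t).eval b + lastParam t * (w - b) := by
  rw [eval_nodeAffine, eval_nodeAffine]
  ring

theorem cons_one_mem_orderedSimplex {t : Fin N → ℝ} (ht : t ∈ orderedSimplex N) :
    (Fin.cons 1 t : Fin (N + 1) → ℝ) ∈ orderedSimplex (N + 1) :=
  cons_mem_scaledSimplex_iff.2 ⟨right_mem_Icc.2 zero_le_one, ht⟩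

theorem lastParam_mem_Icc {t : Fin N → ℝ} (ht : t ∈ orderedSimplex N) :
    lastParam t ∈ Icc 0 1 :=
  (cons_one_mem_orderedSimplex ht).2 _

theorem snoc_mem_orderedSimplex_iff {t : Fin N → ℝ} {x : ℝ} :
    (Fin.snoc t x : Fin (N + 1) → ℝ) ∈ orderedSimplex (N + 1) ↔
      t ∈ orderedSimplex N ∧ x ∈ Icc 0 (lastParam t) := by
  constructor
  · intro h
    refine ⟨⟨fun i j hij => ?_, fun k => by simpa using h.2 k.castSucc⟩,
      by simpa using (h.2 (Fin.last N)).1, ?_⟩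
    · simpa using h.1 (Fin.castSucc_le_castSucc_iff.2 hij)
    · have hlast := (cons_one_mem_orderedSimplex h).1 (Fin.castSucc_le_succ (Fin.last N))
      rwa [Fin.cons_snoc_eq_snoc_cons, Fin.succ_last, Fin.snoc_last, Fin.snoc_castSucc] at hlast
  · intro ⟨ht, hx⟩
    have hle (i : Fin N) : x ≤ t i :=
      hx.2.trans
        (by simpa [lastParam] using (cons_one_mem_orderedSimplex ht).1 (Fin.le_last i.succ))
    refine ⟨fun i j hij => ?_, fun k => ?_⟩
    · cases j using Fin.lastCases with
      | last =>
        cases i using Fin.lastCases with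
        | last => rfl
        | cast i => simpa using hle i
      | cast j =>
        cases i using Fin.lastCases with
        | last => exact absurd (hij.trans_lt (Fin.castSucc_lt_last j)) (lt_irrefl _)
        | cast i => simpa using ht.1 (Fin.castSucc_le_castSucc_iff.1 hij)
    · cases k using Fin.lastCases with
      | last => simpa using ⟨hx.1, hx.2.trans (lastParam_mem_Icc ht).2⟩
      | cast k => simpa using ht.2 k

theorem eval_nodeAffine_mem (hV : Convex ℝ V) {z : Fin N → ℂ} (hz : ∀ k, z k ∈ V) {w : ℂ}
    (hw : w ∈ V) {t : Fin N → ℝ} (ht : t ∈ orderedSimplex N) :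
    (nodeAffine z t).eval w ∈ V := by
  induction N generalizing w with
  | zero => simpa [eval_nodeAffine, nodeCenter, lastParam] using hw
  | succ N ih =>
    cases t using Fin.snocCases with | _ t x
    obtain ⟨ht, hx0, hx⟩ := snoc_mem_orderedSimplex_iff.1 ht
    set b := z (Fin.last N)
    have hθ : x / lastParam t * lastParam t = x :=
      div_mul_cancel_of_imp fun h => le_antisymm (hx.trans_eq h) hx0
    have hmem : b + (x / lastParam t) • (w - b) ∈ V :=
      hV.add_smul_sub_mem (hz _) hw
        ⟨div_nonneg hx0 (hx0.trans hx), div_le_one_of_le₀ hx (hx0.trans hx)⟩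
    have heval : (nodeAffine z (Fin.snoc t x : Fin (N + 1) → ℝ)).eval w =
        (nodeAffine (Fin.init z) t).eval (b + (x / lastParam t) • (w - b)) := by
      rw [eval_nodeAffine_snoc, eval_nodeAffine_eq_add _ _ b (b + _), add_sub_cancel_left,
        real_smul, ← mul_assoc, ← ofReal_mul, mul_comm (lastParam t), hθ]
    rw [heval]
    exact ih (fun k => hz k.castSucc) hmem ht

end NodeSegments

section GenocchiHermite

variable {N : ℕ} {V : Set ℂ} {g : ℂ → ℂ} {z : Fin N → ℂ} {w : ℂ}

/-- The Genocchi–Hermite integral of the `N`-th derivative of `g`: the divided difference of `g`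
at the `N + 1` points `z_1, …, z_N, w`. -/
noncomputable def genocchiHermite (g : ℂ → ℂ) (z : Fin N → ℂ) (w : ℂ) : ℂ :=
  iterIntegral N (fun t => iteratedDeriv N g ((nodeAffine z t).eval w)) 1

theorem continuousOn_uncurry_eval_nodeAffine (hVc : Convex ℝ V) (hg : ContinuousOn g V)
    (hz : ∀ k, z k ∈ V) :
    ContinuousOn (Function.uncurry fun t w => g ((nodeAffine z t).eval w))
      (orderedSimplex N ×ˢ V) :=
  hg.comp (continuous_eval_nodeAffine z).continuousOn
    fun _ hp => eval_nodeAffine_mem hVc hz hp.2 hp.1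

theorem continuousOn_eval_nodeAffine (hVc : Convex ℝ V) (hg : ContinuousOn g V)
    (hz : ∀ k, z k ∈ V) (hw : w ∈ V) :
    ContinuousOn (fun t => g ((nodeAffine z t).eval w)) (orderedSimplex N) :=
  (continuousOn_uncurry_eval_nodeAffine hVc hg hz).comp (f := fun t => (t, w)) (by fun_prop)
    fun _ ht => ⟨ht, hw⟩

theorem analyticOnNhd_comp_nodeAffine (hVc : Convex ℝ V) (hg : AnalyticOnNhd ℂ g V)
    (hz : ∀ k, z k ∈ V) {t : Fin N → ℝ} (ht : t ∈ orderedSimplex N) :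
    AnalyticOnNhd ℂ (fun w => g ((nodeAffine z t).eval w)) V :=
  hg.comp (analyticOnNhd_eval _ V) fun _ hw => eval_nodeAffine_mem hVc hz hw ht

theorem analyticOnNhd_iteratedDeriv (hg : AnalyticOnNhd ℂ g V) (N : ℕ) :
    AnalyticOnNhd ℂ (iteratedDeriv N g) V := by
  rw [iteratedDeriv_eq_iterate]
  exact hg.iterated_deriv N

theorem genocchiHermite_eq_setIntegral (hVc : Convex ℝ V) (hg : AnalyticOnNhd ℂ g V)
    (hz : ∀ k, z k ∈ V) (hw : w ∈ V) :
    genocchiHermite g z w =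
      ∫ t in orderedSimplex N, iteratedDeriv N g ((nodeAffine z t).eval w) :=
  iterIntegral_eq_setIntegral zero_le_one
    (continuousOn_eval_nodeAffine hVc (analyticOnNhd_iteratedDeriv hg N).continuousOn hz hw)

theorem analyticOnNhd_genocchiHermite (hV : IsOpen V) (hVc : Convex ℝ V)
    (hg : AnalyticOnNhd ℂ g V) (hz : ∀ k, z k ∈ V) : AnalyticOnNhd ℂ (genocchiHermite g z) V :=
  (analyticOnNhd_setIntegral (isCompact_scaledSimplex N 1) hV
    (continuousOn_uncurry_eval_nodeAffine hVc (analyticOnNhd_iteratedDeriv hg N).continuousOn hz)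
    fun _ ht => analyticOnNhd_comp_nodeAffine hVc (analyticOnNhd_iteratedDeriv hg N) hz ht).congr hV
      fun _ hw => (genocchiHermite_eq_setIntegral hVc hg hz hw).symm

theorem mul_integral_deriv_add_mul (hg : AnalyticOnNhd ℂ g V) {p c : ℂ} {τ : ℝ} (hτ : 0 ≤ τ)
    (h : ∀ x ∈ Icc 0 τ, p + x * c ∈ V) :
    c * ∫ x in (0 : ℝ)..τ, deriv g (p + x * c) = g (p + τ * c) - g p := by
  rw [← uIcc_of_le hτ] at h
  have hderiv : ∀ x ∈ uIcc 0 τ,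
      HasDerivAt (fun x : ℝ => g (p + x * c)) (c * deriv g (p + x * c)) x := by
    intro x hx
    have hline : HasDerivAt (fun y : ℂ => p + y * c) c x := by
      simpa using ((hasDerivAt_id (x : ℂ)).mul_const c).const_add p
    rw [mul_comm]
    exact ((hg _ (h x hx)).differentiableAt.hasDerivAt.comp (x : ℂ) hline).comp_ofReal
  have hcont : ContinuousOn (fun x : ℝ => c * deriv g (p + x * c)) (uIcc 0 τ) :=
    continuousOn_const.mul (hg.deriv.continuousOn.comp (by fun_prop) h)
  rw [← intervalIntegral.integral_const_mul,
    intervalIntegral.integral_eq_sub_of_hasDerivAt hderiv hcont.intervalIntegrable]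
  simp

/-- The recursion for divided differences: integrate over the innermost parameter `t_{N+1}`. -/
theorem sub_mul_genocchiHermite {z : Fin (N + 1) → ℂ} (hVc : Convex ℝ V)
    (hg : AnalyticOnNhd ℂ g V) (hz : ∀ k, z k ∈ V) (hw : w ∈ V) :
    (w - z (Fin.last N)) * genocchiHermite g z w =
      genocchiHermite g (Fin.init z) w - genocchiHermite g (Fin.init z) (z (Fin.last N)) := by
  set b := z (Fin.last N)
  have hgN := analyticOnNhd_iteratedDeriv hg N
  have hcont {v : ℂ} (hv : v ∈ V) :=
    continuousOn_eval_nodeAffine (z := Fin.init z) hVc hgN.continuousOn (fun k => hz k.castSucc) hv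
  simp only [genocchiHermite]
  rw [iterIntegral_succ_last, ← iterIntegral_const_mul,
    ← iterIntegral_sub zero_le_one (hcont hw) (hcont (hz _))]
  refine iterIntegral_congr zero_le_one fun t ht => ?_
  have hmem : ∀ x ∈ Icc 0 (lastParam t),
      (nodeAffine (Fin.init z) t).eval b + x * (w - b) ∈ V := fun x hx => by
    rw [← eval_nodeAffine_snoc]
    exact eval_nodeAffine_mem hVc hz hw (snoc_mem_orderedSimplex_iff.2 ⟨ht, hx⟩)
  simp only [eval_nodeAffine_snoc, iteratedDeriv_succ]
  exact (mul_integral_deriv_add_mul hgN (lastParam_mem_Icc ht).1 hmem).trans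
    (by rw [← eval_nodeAffine_eq_add])

theorem analyticOrderAt_eval_mul (p q : ℂ[X]) (a : ℂ) :
    analyticOrderAt (fun w => (p * q).eval w) a =
      analyticOrderAt (fun w => p.eval w) a + analyticOrderAt (fun w => q.eval w) a := by
  simp only [Polynomial.eval_mul]
  exact analyticOrderAt_mul (analyticAt_eval p a) (analyticAt_eval q a)

theorem analyticOrderAt_eval_X_sub_C (a b : ℂ) :
    analyticOrderAt (fun w => (Polynomial.X - Polynomial.C b).eval w) a =
      if b = a then 1 else 0 := by
  simp only [Polynomial.eval_sub, Polynomial.eval_X, Polynomial.eval_C]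
  split_ifs with h
  · rw [h]
    exact analyticOrderAt_id_sub_const_self
  · exact analyticOrderAt_id_sub_const_of_ne (Ne.symm h)

theorem nodePoly_succ (z : Fin (N + 1) → ℂ) :
    nodePoly z = nodePoly (Fin.init z) * (Polynomial.X - Polynomial.C (z (Fin.last N))) :=
  Fin.prod_univ_castSucc _

theorem analyticOrderAt_eval_nodePoly (z : Fin N → ℂ) (a : ℂ) :
    analyticOrderAt (fun w => (nodePoly z).eval w) a =
      (Finset.univ.filter fun i => z i = a).card := by
  rw [Finset.card_filter]
  push_cast
  induction N with
  | zero => simpa [nodePoly] using analyticAt_const.analyticOrderAt_eq_zero.2 one_ne_zero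
  | succ N ih =>
    rw [nodePoly_succ, analyticOrderAt_eval_mul, analyticOrderAt_eval_X_sub_C, ih,
      Fin.sum_univ_castSucc]
    rfl

theorem apply_eq_zero_of_analyticOrderAt_lt_mul {φ ψ : ℂ → ℂ} {a : ℂ} (hφ : AnalyticAt ℂ φ a)
    (hψ : AnalyticAt ℂ ψ a) (h : analyticOrderAt φ a < analyticOrderAt (φ * ψ) a) : ψ a = 0 := by
  by_contra hne
  rw [analyticOrderAt_mul hφ hψ, hψ.analyticOrderAt_eq_zero.2 hne, add_zero] at h
  exact lt_irrefl _ h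

/-- Split off the last node: the quotient of `g` by the other factors of `Ω` still vanishes
there. -/
theorem eq_eval_nodePoly_mul_genocchiHermite (hV : IsOpen V) (hVc : Convex ℝ V)
    (hg : AnalyticOnNhd ℂ g V) (hz : ∀ k, z k ∈ V)
    (hord : ∀ k, analyticOrderAt (fun w => (nodePoly z).eval w) (z k) ≤ analyticOrderAt g (z k))
    (hw : w ∈ V) : g w = (nodePoly z).eval w * genocchiHermite g z w := by
  induction N generalizing w with
  | zero => simp [nodePoly, genocchiHermite, iterIntegral, nodeAffine, nodeCenter, lastParam]
  | succ N ih =>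
    set b := z (Fin.last N)
    set Ω := nodePoly (Fin.init z)
    have hz' : ∀ k, Fin.init z k ∈ V := fun k => hz k.castSucc
    simp only [nodePoly_succ, analyticOrderAt_eval_mul] at hord
    have hquot : EqOn g ((fun w => Ω.eval w) * genocchiHermite g (Fin.init z)) V := fun w hw =>
      ih hz' (fun k => le_self_add.trans (hord k.castSucc)) hw
    have hzero : genocchiHermite g (Fin.init z) b = 0 := by
      refine apply_eq_zero_of_analyticOrderAt_lt_mul (analyticAt_eval Ω b)
        (analyticOnNhd_genocchiHermite hV hVc hg hz' b (hz _)) ?_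
      rw [← analyticOrderAt_congr (hquot.eventuallyEq_of_mem (hV.mem_nhds (hz _))),
        ← ENat.add_one_le_iff (by simp [Ω, analyticOrderAt_eval_nodePoly])]
      simpa [analyticOrderAt_eval_X_sub_C] using hord (Fin.last N)
    have hrec := sub_mul_genocchiHermite hVc hg hz hw
    rw [hzero, sub_zero] at hrec
    rw [hquot hw, Pi.mul_apply, ← hrec, nodePoly_succ, Polynomial.eval_mul, Polynomial.eval_sub,
      Polynomial.eval_X, Polynomial.eval_C, mul_assoc]

end GenocchiHermite

section Interpolation

variable {N : ℕ} {V : Set ℂ} {f r : ℂ → ℂ} {z : Fin N → ℂ} {u v : ℂ[X]}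

theorem Interpolates.nodeMult_le_analyticOrderAt_sub (h : Interpolates r f z) {k : Fin N}
    (hf : AnalyticAt ℂ f (z k)) (hr : AnalyticAt ℂ r (z k)) :
    (nodeMult z k : ℕ∞) ≤ analyticOrderAt (fun w => f w - r w) (z k) := by
  refine (natCast_le_analyticOrderAt_iff_iteratedDeriv_eq_zero (hf.fun_sub hr)).2 fun j hj => ?_
  rw [iteratedDeriv_fun_sub hf.contDiffAt hr.contDiffAt, h k j hj, sub_self]

theorem Interpolates.nodeMult_le_analyticOrderAt_mul_sub
    (h : Interpolates (fun w => u.eval w / v.eval w) f z) {k : Fin N}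
    (hf : AnalyticAt ℂ f (z k)) (hv : v.eval (z k) ≠ 0) :
    (nodeMult z k : ℕ∞) ≤ analyticOrderAt (fun w => v.eval w * f w - u.eval w) (z k) := by
  have hva := analyticAt_eval v (z k)
  have hra : AnalyticAt ℂ (fun w => u.eval w / v.eval w) (z k) :=
    (analyticAt_eval u (z k)).fun_div hva hv
  have hmul : (fun w => v.eval w * f w - u.eval w) =ᶠ[𝓝 (z k)]
      (fun w => v.eval w) * fun w => f w - u.eval w / v.eval w := by
    filter_upwards [hva.continuousAt.eventually_ne hv] with w hw
    rw [Pi.mul_apply, mul_sub, mul_div_cancel₀ _ hw]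
  rw [analyticOrderAt_congr hmul, analyticOrderAt_mul hva (hf.fun_sub hra)]
  exact (h.nodeMult_le_analyticOrderAt_sub hf hra).trans le_add_self

theorem iteratedDeriv_eval (p : ℂ[X]) (N : ℕ) :
    iteratedDeriv N (fun w => p.eval w) = fun w => (Polynomial.derivative^[N] p).eval w := by
  induction N with
  | zero => rfl
  | succ N ih =>
    ext w
    rw [iteratedDeriv_succ, ih, Function.iterate_succ_apply', Polynomial.deriv]

theorem iteratedDeriv_sub_eval {g : ℂ → ℂ} {w : ℂ} (hg : AnalyticAt ℂ g w)
    (hu : u.degree < N) :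
    iteratedDeriv N (fun w => g w - u.eval w) w = iteratedDeriv N g w := by
  rw [iteratedDeriv_fun_sub hg.contDiffAt
    (analyticAt_eval u w).contDiffAt, iteratedDeriv_eval,
    Polynomial.iterate_derivative_eq_zero_of_degree_lt hu]
  simp only [Polynomial.eval_zero, sub_zero]

theorem genocchiHermite_sub_eval {g : ℂ → ℂ} {w : ℂ} (hVc : Convex ℝ V)
    (hg : AnalyticOnNhd ℂ g V) (hz : ∀ k, z k ∈ V) (hw : w ∈ V) (hu : u.degree < N) :
    genocchiHermite (fun w => g w - u.eval w) z w = genocchiHermite g z w :=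
  iterIntegral_congr zero_le_one fun _ ht =>
    iteratedDeriv_sub_eval (hg _ (eval_nodeAffine_mem hVc hz hw ht)) hu

theorem Interpolates.eval_mul_sub_eval (h : Interpolates (fun w => u.eval w / v.eval w) f z)
    (hV : IsOpen V) (hVc : Convex ℝ V) (hf : AnalyticOnNhd ℂ f V) (hz : ∀ k, z k ∈ V)
    (hu : u.degree < N) (hv : ∀ k, v.eval (z k) ≠ 0) {w : ℂ} (hw : w ∈ V) :
    v.eval w * f w - u.eval w =
      (nodePoly z).eval w * genocchiHermite (fun w => v.eval w * f w) z w := by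
  have hvf : AnalyticOnNhd ℂ (fun w => v.eval w * f w) V :=
    (analyticOnNhd_eval v V).mul hf
  have hg : AnalyticOnNhd ℂ (fun w => v.eval w * f w - u.eval w) V :=
    hvf.sub (analyticOnNhd_eval u V)
  rw [← genocchiHermite_sub_eval hVc hvf hz hw hu]
  exact eq_eval_nodePoly_mul_genocchiHermite (g := fun w => v.eval w * f w - u.eval w) hV hVc hg hz
    (fun k => (analyticOrderAt_eval_nodePoly z (z k)).trans_le
      (h.nodeMult_le_analyticOrderAt_mul_sub (hf _ (hz k)) (hv k))) hw

end Interpolation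

section ErrorFormula

variable {n N : ℕ} {A : Matrix (Fin n) (Fin n) ℂ} {V : Set ℂ} {f g : ℂ → ℂ} {z : Fin N → ℂ}
  {u v : ℂ[X]}

theorem matFun_nodeMatrix (hVc : Convex ℝ V) (hA : spectrum ℂ A ⊆ V) (hg : AnalyticOnNhd ℂ g V)
    (hz : ∀ k, z k ∈ V) {t : Fin N → ℝ} (ht : t ∈ orderedSimplex N) :
    matFun g (nodeMatrix z A t) = matFun (fun w => g ((nodeAffine z t).eval w)) A := by
  rw [← aeval_nodeAffine, matFun_aeval]
  exact hg.mono (image_subset_iff.2 fun μ hμ => eval_nodeAffine_mem hVc hz (hA hμ) ht)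

theorem continuousOn_matFun_nodeMatrix (hV : IsOpen V) (hVc : Convex ℝ V)
    (hA : spectrum ℂ A ⊆ V) (hg : AnalyticOnNhd ℂ g V) (hz : ∀ k, z k ∈ V) :
    ContinuousOn (fun t => matFun g (nodeMatrix z A t)) (orderedSimplex N) :=
  (continuousOn_matFun hV hA (continuousOn_uncurry_eval_nodeAffine hVc hg.continuousOn hz)
    fun _ ht => analyticOnNhd_comp_nodeAffine hVc hg hz ht).congr
      fun _ ht => matFun_nodeMatrix hVc hA hg hz ht

theorem matFun_genocchiHermite (hV : IsOpen V) (hVc : Convex ℝ V) (hA : spectrum ℂ A ⊆ V)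
    (hg : AnalyticOnNhd ℂ g V) (hz : ∀ k, z k ∈ V) :
    matFun (genocchiHermite g z) A =
      iterIntegralMatrix N (fun t => matFun (iteratedDeriv N g) (nodeMatrix z A t)) 1 := by
  have hgN := analyticOnNhd_iteratedDeriv hg N
  have hcont := continuousOn_matFun_nodeMatrix hV hVc hA hgN hz
  have hK : IsCompact (orderedSimplex N) := isCompact_scaledSimplex N 1
  ext i j
  calc matFun (genocchiHermite g z) A i j
    _ = matFun (fun w => ∫ t in orderedSimplex N,
          iteratedDeriv N g ((nodeAffine z t).eval w)) A i j := by
      rw [matFun_congr hV hA (analyticOnNhd_genocchiHermite hV hVc hg hz)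
        fun w hw => genocchiHermite_eq_setIntegral hVc hg hz hw]
    _ = ∫ t in orderedSimplex N,
          matFun (fun w => iteratedDeriv N g ((nodeAffine z t).eval w)) A i j :=
      matFun_setIntegral_apply hK hV hA
        (continuousOn_uncurry_eval_nodeAffine hVc hgN.continuousOn hz)
        (fun _ ht => analyticOnNhd_comp_nodeAffine hVc hgN hz ht) i j
    _ = ∫ t in orderedSimplex N, matFun (iteratedDeriv N g) (nodeMatrix z A t) i j :=
      setIntegral_congr_fun hK.measurableSet fun t ht => by
        rw [← matFun_nodeMatrix hVc hA hgN hz ht]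
    _ = iterIntegralMatrix N (fun t => matFun (iteratedDeriv N g) (nodeMatrix z A t)) 1 i j :=
      (iterIntegral_eq_setIntegral zero_le_one
        (continuousOn_pi.1 (continuousOn_pi.1 hcont i) j)).symm

theorem aeval_mul_matFun_div (hv : ∀ μ ∈ spectrum ℂ A, v.eval μ ≠ 0) :
    Polynomial.aeval A v * matFun (fun w => u.eval w / v.eval w) A = Polynomial.aeval A u := by
  rw [← matFun_eval_mul (f := fun w => u.eval w / v.eval w)
    ((analyticOnNhd_eval u _).div (analyticOnNhd_eval v _) hv), ← matFun_eval]
  exact (matFun_congr (isOpen_ne_fun v.continuous continuous_const) hv (analyticOnNhd_eval u _)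
    fun w hw => (mul_div_cancel₀ _ hw).symm).symm

theorem Interpolates.aeval_mul_matFun_sub (h : Interpolates (fun w => u.eval w / v.eval w) f z)
    (hV : IsOpen V) (hVc : Convex ℝ V) (hA : spectrum ℂ A ⊆ V) (hf : AnalyticOnNhd ℂ f V)
    (hz : ∀ k, z k ∈ V) (hu : u.degree < N) (hvz : ∀ k, v.eval (z k) ≠ 0)
    (hvA : ∀ μ ∈ spectrum ℂ A, v.eval μ ≠ 0) :
    Polynomial.aeval A v * (matFun f A - matFun (fun w => u.eval w / v.eval w) A) =
      Polynomial.aeval A (nodePoly z) * matFun (genocchiHermite (fun w => v.eval w * f w) z) A := by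
  have hvf : AnalyticOnNhd ℂ (fun w => v.eval w * f w) V := (analyticOnNhd_eval v V).mul hf
  have hgen := analyticOnNhd_genocchiHermite hV hVc hvf hz
  rw [mul_sub, aeval_mul_matFun_div hvA, ← matFun_eval_mul (hf.mono hA), ← matFun_eval,
    ← matFun_sub (hvf.mono hA) (analyticOnNhd_eval u _), ← matFun_eval_mul (hgen.mono hA)]
  exact matFun_congr hV hA (hvf.sub (analyticOnNhd_eval u V))
    fun w hw => h.eval_mul_sub_eval hV hVc hf hz hu hvz hw

end ErrorFormula

end RatInterp

theorem theoremt {n N : ℕ} (A : Matrix (Fin n) (Fin n) ℂ) (z : Fin N → ℂ)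
    (U : Set ℂ) (hU : IsOpen U)
    (hKU : convexHull ℝ (spectrum ℂ A ∪ Set.range z) ⊆ U)
    (f : ℂ → ℂ) (hf : AnalyticOnNhd ℂ f U)
    (u v : Polynomial ℂ)
    (hr : RatInterp.Interpolates (fun w => u.eval w / v.eval w) f z)
    (hdeg : u.degree < (N : WithBot ℕ))
    (hvz : ∀ k, v.eval (z k) ≠ 0)
    (hvA : ∀ μ ∈ spectrum ℂ A, v.eval μ ≠ 0) :
    -- the objects on the right-hand side make sense
    IsUnit (Polynomial.aeval A v) ∧
    ContinuousOn
      (fun t => RatInterp.matFun (iteratedDeriv N fun w => v.eval w * f w)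
        (RatInterp.nodeMatrix z A t))
      (RatInterp.orderedSimplex N) ∧
    -- the formula for the error
    RatInterp.matFun f A - RatInterp.matFun (fun w => u.eval w / v.eval w) A =
      Polynomial.aeval A (RatInterp.nodePoly z) * (Polynomial.aeval A v)⁻¹ *
        RatInterp.iterIntegralMatrix N
          (fun t => RatInterp.matFun (iteratedDeriv N fun w => v.eval w * f w)
            (RatInterp.nodeMatrix z A t)) 1 := by
  obtain ⟨V, hV, hVc, hSV, hVU⟩ := RatInterp.exists_isOpen_convex_of_convexHull_subset
    ((Matrix.finite_spectrum A).union (Set.finite_range z)) hU hKU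
  obtain ⟨hA, hz⟩ := Set.union_subset_iff.1 hSV
  rw [Set.range_subset_iff] at hz
  have hfV := hf.mono hVU
  have hvf : AnalyticOnNhd ℂ (fun w => v.eval w * f w) V :=
    (RatInterp.analyticOnNhd_eval v V).mul hfV
  have hunit := RatInterp.isUnit_aeval_of_eval_ne_zero hvA
  refine ⟨hunit, RatInterp.continuousOn_matFun_nodeMatrix hV hVc hA
    (RatInterp.analyticOnNhd_iteratedDeriv hvf N) hz, ?_⟩
  rw [← RatInterp.matFun_genocchiHermite hV hVc hA hvf hz]
  exact RatInterp.eq_mul_inv_mul_of_commute ((Commute.all _ v).map (Polynomial.aeval A))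
    hunit (hr.aeval_mul_matFun_sub hV hVc hA hfV hz hdeg hvz hvA)
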